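/- Let $\mathcal X$ be a set, $c:\mathcal X\times\mathcal X\to[0,\infty)$ a cost with $c(x,x)=0$ for all $x$, let $\lambda>0$, and let $C_\lambda(x,y)=\min\{c(x,y),2\lambda\}$. **(Discrete case.)** Let $X_1,\dots,X_n,Y_1,\dots,Y_m\in\mathcal X$, let $\mu\in\Delta^{n-1}$ and $\nu\in\Delta^{m-1}$ be probability vectors, and let $(Z_1,\dots,Z_{n+m})=(X_1,\dots,X_n,Y_1,\dots,Y_m)$. Consider - (F1) minimize $\sum_{k,l}c(Z_k,Z_l)\Pi_{kl}+\lambda(\|s\|_1+\|t\|_1)$ over $\Pi\in\mathbb R_{\ge0}^{(n+m)\times(n+m)}$, $s\in\mathbb R^n$, $t\in\mathbb R^m$ such that $\Pi$ has row sums $(\mu+s,\,t)$ and column sums $(0,\nu)$, and $\sum_i s_i+\sum_j t_j=0$; - (F2) minimize $\sum_{i,j}C_\lambda(X_i,Y_j)\Pi_{ij}$ over $\Pi\in\mathbb R_{\ge0}^{n\times m}$ with row sums $\mu$ and column sums $\nu$. Then both minima are attained and they are equal. If $\Pi$ is optimal for (F2) and $R_{ij}=\Pi_{ij}\mathbf 1\{c(X_i,Y_j)>2\lambda\}$,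 then the plan $\begin{bmatrix}0&\Pi-R\\0&\mathrm{diag}(t)\end{bmatrix}$ together with $s_i=-\sum_jR_{ij}$ and $t_j=\sum_iR_{ij}$ is optimal for (F1). Conversely, let $(\Pi,s,t)$ be optimal for (F1), and set $K_{ij}=\frac{\min\{\mu_i,\mu_i+s_i\}}{\mu_i+s_i}\Pi_{i,n+j}$ (with $K_{ij}=0$ if $\mu_i+s_i=0$), $s_i^-=\max\{-s_i,0\}$ and $D=\sum_i s_i^-$. Then the matrix with entries $K_{ij}+s_i^-\bigl(\nu_j-\sum_{i'}K_{i'j}\bigr)/D$ (just $K_{ij}$ if $D=0$) is optimal for (F2). **(General case.)** Suppose in addition that $\mathcal X$ is a measurable space and that $c$ is a (jointly measurable) metric on $\mathcal X$. Let $\mu,\nu$ be probability measures on $\mathcal X$. Consider - (F1) minimize $\int c\,d\pi+\lambda|s|(\mathcal X)$ over finite signed measures $s$ on $\mathcal X$ with $s(\mathcal X)=0$ and measures $\pi\ge0$ on $\mathcal X\times\mathcal X$ with first marginal $\mu+s$ and second marginal $\nu$, where $|s|$ is the total variation measure of $s$; - (F2) minimize $\int C_\lambda\,d\pi$ over the couplings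 $\pi$ of $\mu$ and $\nu$. Then the two optimal values (infima) are equal. If $\pi$ is optimal for (F2) and $\rho$ is the restriction of $\pi$ to $\{c>2\lambda\}$, then the plan $\pi-\rho$ plus the image of $\rho$ under $(x,y)\mapsto(y,y)$, together with $s=(\text{second marginal of }\rho)-(\text{first marginal of }\rho)$, is optimal for (F1). Conversely, let $(\pi,s)$ be optimal for (F1), let $s=s^+-s^-$ be the Jordan decomposition, and let $\kappa$ be the measure with density $(x,y)\mapsto\frac{d(\mu-s^-)}{d(\mu+s)}(x)$ with respect to $\pi$. Then $\kappa+\frac{1}{s^-(\mathcal X)}\,s^-\otimes(\nu-\kappa_2)$ is optimal for (F2), where $\kappa_2$ is the second marginal of $\kappa$ (and the last term is absent if $s^-=0$). -/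

import Mathlib

/-! Robust optimal transport (ROBOT): the two formulations, for finitely supported and for
general probability measures, and the maps between their solutions. -/

noncomputable section

namespace ROBOT

open MeasureTheory
open scoped ENNReal

/-! ### Finitely supported measures

The measures are `∑ i, μ i • δ_{X i}` and `∑ j, ν j • δ_{Y j}`.  The augmented support is indexed by
`Fin n ⊕ Fin m`, with points `Sum.elim X Y`. -/

section Discrete

variable {𝒳 : Type*} {n m : ℕ}

/-- The truncated cost `min {c(x, y), 2λ}`. -/
def truncCost (c : 𝒳 → 𝒳 → ℝ) (lam : ℝ) (x y : 𝒳) : ℝ := min (c x y) (2 * lam)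

/-- The augmented cost matrix `c(Z_k, Z_l)`, where `Z = (X_1, …, X_n, Y_1, …, Y_m)`. -/
def augCost (c : 𝒳 → 𝒳 → ℝ) (X : Fin n → 𝒳) (Y : Fin m → 𝒳) :
    Matrix (Fin n ⊕ Fin m) (Fin n ⊕ Fin m) ℝ :=
  fun k l => c (Sum.elim X Y k) (Sum.elim X Y l)

/-- The constraints of the discrete Formulation 1 on `(Π, s, t)`: the row sums of `Π` are
`(μ + s, t)`, the column sums are `(0, ν)`, the entries of `Π` are nonnegative, and the entries of
`(s, t)` sum to zero. -/
structure DiscreteFeasible₁ (μ : Fin n → ℝ) (ν : Fin m → ℝ)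
    (P : Matrix (Fin n ⊕ Fin m) (Fin n ⊕ Fin m) ℝ) (s : Fin n → ℝ) (t : Fin m → ℝ) : Prop where
  nonneg : ∀ k l, 0 ≤ P k l
  row_left : ∀ i : Fin n, ∑ l, P (Sum.inl i) l = μ i + s i
  row_right : ∀ j : Fin m, ∑ l, P (Sum.inr j) l = t j
  col_left : ∀ i : Fin n, ∑ k, P k (Sum.inl i) = 0
  col_right : ∀ j : Fin m, ∑ k, P k (Sum.inr j) = ν j
  sum_zero : ∑ i, s i + ∑ j, t j = 0

/-- The objective `⟨C_aug, Π⟩ + λ (‖s‖₁ + ‖t‖₁)` of the discrete Formulation 1. -/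
def discreteObj₁ (c : 𝒳 → 𝒳 → ℝ) (lam : ℝ) (X : Fin n → 𝒳) (Y : Fin m → 𝒳)
    (P : Matrix (Fin n ⊕ Fin m) (Fin n ⊕ Fin m) ℝ) (s : Fin n → ℝ) (t : Fin m → ℝ) : ℝ :=
  ∑ k, ∑ l, augCost c X Y k l * P k l + lam * (∑ i, |s i| + ∑ j, |t j|)

/-- The constraints of the discrete Formulation 2: `Π` is a coupling of `μ` and `ν`. -/
structure DiscreteFeasible₂ (μ : Fin n → ℝ) (ν : Fin m → ℝ)
    (P : Matrix (Fin n) (Fin m) ℝ) : Prop where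
  nonneg : ∀ i j, 0 ≤ P i j
  row : ∀ i, ∑ j, P i j = μ i
  col : ∀ j, ∑ i, P i j = ν j

/-- The objective `⟨C_λ, Π⟩` of the discrete Formulation 2. -/
def discreteObj₂ (c : 𝒳 → 𝒳 → ℝ) (lam : ℝ) (X : Fin n → 𝒳) (Y : Fin m → 𝒳)
    (P : Matrix (Fin n) (Fin m) ℝ) : ℝ :=
  ∑ i, ∑ j, truncCost c lam (X i) (Y j) * P i j

/-- The objective values attained by feasible points of the discrete Formulation 1. -/
def discreteValues₁ (c : 𝒳 → 𝒳 → ℝ) (lam : ℝ) (X : Fin n → 𝒳) (Y : Fin m → 𝒳)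
    (μ : Fin n → ℝ) (ν : Fin m → ℝ) : Set ℝ :=
  {v | ∃ P s t, DiscreteFeasible₁ μ ν P s t ∧ discreteObj₁ c lam X Y P s t = v}

/-- The objective values attained by feasible points of the discrete Formulation 2. -/
def discreteValues₂ (c : 𝒳 → 𝒳 → ℝ) (lam : ℝ) (X : Fin n → 𝒳) (Y : Fin m → 𝒳)
    (μ : Fin n → ℝ) (ν : Fin m → ℝ) : Set ℝ :=
  {v | ∃ P, DiscreteFeasible₂ μ ν P ∧ discreteObj₂ c lam X Y P = v}

/-- `(Π, s, t)` is an optimal solution of the discrete Formulation 1. -/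
def DiscreteOptimal₁ (c : 𝒳 → 𝒳 → ℝ) (lam : ℝ) (X : Fin n → 𝒳) (Y : Fin m → 𝒳)
    (μ : Fin n → ℝ) (ν : Fin m → ℝ)
    (P : Matrix (Fin n ⊕ Fin m) (Fin n ⊕ Fin m) ℝ) (s : Fin n → ℝ) (t : Fin m → ℝ) : Prop :=
  DiscreteFeasible₁ μ ν P s t ∧
    ∀ P' s' t', DiscreteFeasible₁ μ ν P' s' t' →
      discreteObj₁ c lam X Y P s t ≤ discreteObj₁ c lam X Y P' s' t'

/-- `Π` is an optimal solution of the discrete Formulation 2. -/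
def DiscreteOptimal₂ (c : 𝒳 → 𝒳 → ℝ) (lam : ℝ) (X : Fin n → 𝒳) (Y : Fin m → 𝒳)
    (μ : Fin n → ℝ) (ν : Fin m → ℝ) (P : Matrix (Fin n) (Fin m) ℝ) : Prop :=
  DiscreteFeasible₂ μ ν P ∧
    ∀ P', DiscreteFeasible₂ μ ν P' → discreteObj₂ c lam X Y P ≤ discreteObj₂ c lam X Y P'

open Classical in
/-- The entries of `Π` on the set `{(i, j) : c(X_i, Y_j) > 2λ}` (zero elsewhere). -/
def cutPart (c : 𝒳 → 𝒳 → ℝ) (lam : ℝ) (X : Fin n → 𝒳) (Y : Fin m → 𝒳)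
    (P : Matrix (Fin n) (Fin m) ℝ) : Matrix (Fin n) (Fin m) ℝ :=
  fun i j => if 2 * lam < c (X i) (Y j) then P i j else 0

/-- From Formulation 2 to Formulation 1, the shift on the points `X_i`: minus the mass cut in
row `i`. -/
def toS (c : 𝒳 → 𝒳 → ℝ) (lam : ℝ) (X : Fin n → 𝒳) (Y : Fin m → 𝒳)
    (P : Matrix (Fin n) (Fin m) ℝ) : Fin n → ℝ :=
  fun i => -∑ j, cutPart c lam X Y P i j

/-- From Formulation 2 to Formulation 1, the shift on the points `Y_j`: the mass cut in
column `j`. -/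
def toT (c : 𝒳 → 𝒳 → ℝ) (lam : ℝ) (X : Fin n → 𝒳) (Y : Fin m → 𝒳)
    (P : Matrix (Fin n) (Fin m) ℝ) : Fin m → ℝ :=
  fun j => ∑ i, cutPart c lam X Y P i j

/-- From Formulation 2 to Formulation 1, the plan: `Π` without the cut entries in the upper right
block, and the mass cut in each column on the diagonal of the lower right block. -/
def toPlan (c : 𝒳 → 𝒳 → ℝ) (lam : ℝ) (X : Fin n → 𝒳) (Y : Fin m → 𝒳)
    (P : Matrix (Fin n) (Fin m) ℝ) : Matrix (Fin n ⊕ Fin m) (Fin n ⊕ Fin m) ℝ :=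
  Matrix.fromBlocks 0 (P - cutPart c lam X Y P) 0 (Matrix.diagonal (toT c lam X Y P))

/-- The part of the upper right block of `Π` that is kept when going from Formulation 1 to
Formulation 2: row `i`, of total mass `μ i + s i`, is scaled down to total mass
`min {μ i, μ i + s i}`. -/
def keptPart (μ : Fin n → ℝ) (P : Matrix (Fin n ⊕ Fin m) (Fin n ⊕ Fin m) ℝ) (s : Fin n → ℝ) :
    Matrix (Fin n) (Fin m) ℝ :=
  fun i j => min (μ i) (μ i + s i) / (μ i + s i) * P (Sum.inl i) (Sum.inr j)

/-- From Formulation 1 to Formulation 2: the kept part, plus the mass then missing in the columns,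
distributed over the rows in proportion to the mass `s⁻` that was removed there. -/
def ofPlan (μ : Fin n → ℝ) (ν : Fin m → ℝ)
    (P : Matrix (Fin n ⊕ Fin m) (Fin n ⊕ Fin m) ℝ) (s : Fin n → ℝ) :
    Matrix (Fin n) (Fin m) ℝ :=
  fun i j => keptPart μ P s i j +
    max (-s i) 0 * (ν j - ∑ i', keptPart μ P s i' j) / ∑ i', max (-s i') 0

end Discrete

/-! ### General probability measures -/

section General

variable {𝒳 : Type*}

/-- `c` is a metric on `𝒳` (nonnegativity follows). -/
structure IsMetric (c : 𝒳 → 𝒳 → ℝ) : Prop where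
  eq_zero_iff : ∀ x y, c x y = 0 ↔ x = y
  symm : ∀ x y, c x y = c y x
  triangle : ∀ x y z, c x z ≤ c x y + c y z

variable [MeasurableSpace 𝒳]

/-- The constraints of Formulation 1: `π` is a measure on `𝒳 × 𝒳` with marginals `μ + s` and `ν`,
where `s` is a finite signed measure of total mass zero.  (In particular `μ + s ≥ 0`.) -/
structure Feasible₁ (μ ν : Measure 𝒳) (π : Measure (𝒳 × 𝒳)) (s : SignedMeasure 𝒳) : Prop where
  fst : ∀ A, MeasurableSet A → π.fst.real A = μ.real A + s A
  snd : π.snd = ν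
  mass_zero : s Set.univ = 0

/-- The objective `∫ c dπ + λ |s|(𝒳)` of Formulation 1, where `|s|` is the total variation measure
of `s`. -/
def obj₁ (c : 𝒳 → 𝒳 → ℝ) (lam : ℝ) (π : Measure (𝒳 × 𝒳)) (s : SignedMeasure 𝒳) : ℝ≥0∞ :=
  ∫⁻ p, ENNReal.ofReal (c p.1 p.2) ∂π + ENNReal.ofReal lam * s.totalVariation Set.univ

/-- The constraints of Formulation 2: `π` is a coupling of `μ` and `ν`. -/
structure Feasible₂ (μ ν : Measure 𝒳) (π : Measure (𝒳 × 𝒳)) : Prop where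
  fst : π.fst = μ
  snd : π.snd = ν

/-- The objective `∫ min {c, 2λ} dπ` of Formulation 2. -/
def obj₂ (c : 𝒳 → 𝒳 → ℝ) (lam : ℝ) (π : Measure (𝒳 × 𝒳)) : ℝ≥0∞ :=
  ∫⁻ p, ENNReal.ofReal (truncCost c lam p.1 p.2) ∂π

/-- The optimal value of Formulation 1. -/
def value₁ (c : 𝒳 → 𝒳 → ℝ) (lam : ℝ) (μ ν : Measure 𝒳) : ℝ≥0∞ :=
  sInf {v | ∃ π s, Feasible₁ μ ν π s ∧ obj₁ c lam π s = v}

/-- The optimal value of Formulation 2. -/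
def value₂ (c : 𝒳 → 𝒳 → ℝ) (lam : ℝ) (μ ν : Measure 𝒳) : ℝ≥0∞ :=
  sInf {v | ∃ π, Feasible₂ μ ν π ∧ obj₂ c lam π = v}

/-- `(π, s)` is an optimal solution of Formulation 1. -/
def Optimal₁ (c : 𝒳 → 𝒳 → ℝ) (lam : ℝ) (μ ν : Measure 𝒳) (π : Measure (𝒳 × 𝒳))
    (s : SignedMeasure 𝒳) : Prop :=
  Feasible₁ μ ν π s ∧ ∀ π' s', Feasible₁ μ ν π' s' → obj₁ c lam π s ≤ obj₁ c lam π' s'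

/-- `π` is an optimal solution of Formulation 2. -/
def Optimal₂ (c : 𝒳 → 𝒳 → ℝ) (lam : ℝ) (μ ν : Measure 𝒳) (π : Measure (𝒳 × 𝒳)) : Prop :=
  Feasible₂ μ ν π ∧ ∀ π', Feasible₂ μ ν π' → obj₂ c lam π ≤ obj₂ c lam π'

/-- The part of `π` on the set `{(x, y) : c(x, y) > 2λ}`. -/
def cutMeasure (c : 𝒳 → 𝒳 → ℝ) (lam : ℝ) (π : Measure (𝒳 × 𝒳)) : Measure (𝒳 × 𝒳) :=
  π.restrict {p | 2 * lam < c p.1 p.2}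

instance (c : 𝒳 → 𝒳 → ℝ) (lam : ℝ) (π : Measure (𝒳 × 𝒳)) [IsFiniteMeasure π] :
    IsFiniteMeasure (cutMeasure c lam π) := by
  unfold cutMeasure; infer_instance

/-- From Formulation 2 to Formulation 1, the plan: the part of `π` on `{c ≤ 2λ}`, plus the part on
`{c > 2λ}` moved to the diagonal by `(x, y) ↦ (y, y)`. -/
def toMeasure (c : 𝒳 → 𝒳 → ℝ) (lam : ℝ) (π : Measure (𝒳 × 𝒳)) : Measure (𝒳 × 𝒳) :=
  π.restrict {p | c p.1 p.2 ≤ 2 * lam} + (cutMeasure c lam π).map (fun p => (p.2, p.2))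

/-- From Formulation 2 to Formulation 1, the modification `s`: the second minus the first marginal
of the part of `π` on `{c > 2λ}`. -/
def toSigned (c : 𝒳 → 𝒳 → ℝ) (lam : ℝ) (π : Measure (𝒳 × 𝒳)) [IsFiniteMeasure π] :
    SignedMeasure 𝒳 :=
  (cutMeasure c lam π).snd.toSignedMeasure - (cutMeasure c lam π).fst.toSignedMeasure

/-- The part of `π` that is kept when going from Formulation 1 to Formulation 2: its first marginal
`μ + s` is scaled down to `μ - s⁻`, where `s = s⁺ - s⁻` is the Jordan decomposition. -/
def keptMeasure (μ : Measure 𝒳) (π : Measure (𝒳 × 𝒳)) (s : SignedMeasure 𝒳) :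
    Measure (𝒳 × 𝒳) :=
  π.withDensity fun p => (μ - s.toJordanDecomposition.negPart).rnDeriv π.fst p.1

/-- From Formulation 1 to Formulation 2: the kept part, plus the normalized product of `s⁻` and the
mass then missing in the second marginal. -/
def ofMeasure (μ ν : Measure 𝒳) (π : Measure (𝒳 × 𝒳)) (s : SignedMeasure 𝒳) : Measure (𝒳 × 𝒳) :=
  keptMeasure μ π s +
    (s.toJordanDecomposition.negPart Set.univ)⁻¹ •
      s.toJordanDecomposition.negPart.prod (ν - (keptMeasure μ π s).snd)

end General

end ROBOT

end

/-!
Both halves of the theorem rest on two cost comparisons that hold for all feasible points, optimal or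
not.

* From a coupling `π` to a modified plan: mass moved at cost above `2λ` is cut and put on the diagonal,
  where it costs nothing, while the shift `s` pays `λ` at each of its two ends. The objective of
  Formulation 1 at the image is therefore at most that of Formulation 2 at `π`
  (`discreteObj₁_toPlan`, `obj₁_toMeasure_le`).
* From `(π, s)` to a coupling: scaling the rows down to `μ - s⁻` does not increase the cost, and the
  missing mass, placed as a product of `s⁻` with the missing column mass, costs at most `2λ` per
  unit. As `s` has total mass zero, the missing mass is half of its total variation, so that the
  objective of Formulation 2 at the image is at most that of Formulation 1 at `(π, s)`
  (`DiscreteFeasible₁.discreteObj₂_ofPlan_le`, `Feasible₁.obj₂_ofMeasure_le`).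

Since both maps preserve feasibility, the values agree and optimal points go to optimal points. In the
finite case the minimum of Formulation 2 exists because the couplings form a compact set, and it is
carried over to Formulation 1.

In the general case, the point that needs care is `s⁻ ≤ μ`, without which the scaled first marginal
`μ - s⁻` would be a truncated difference. It follows from the minimality of the Jordan decomposition
among all representations of `s` as a difference of measures (`negPart_le_of_eq_sub`), since
`s = π₁ - μ`.
-/

namespace ROBOT

/-! ### Finitely supported measures -/

section Discrete

variable {𝒳 : Type*} {n m : ℕ} {c : 𝒳 → 𝒳 → ℝ} {lam : ℝ} {X : Fin n → 𝒳} {Y : Fin m → 𝒳}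
  {μ : Fin n → ℝ} {ν : Fin m → ℝ}

lemma discreteObj₁_eq (P : Matrix (Fin n ⊕ Fin m) (Fin n ⊕ Fin m) ℝ) (s : Fin n → ℝ)
    (t : Fin m → ℝ) (hP : ∀ k i, P k (Sum.inl i) = 0) :
    discreteObj₁ c lam X Y P s t =
      ∑ i, ∑ j, c (X i) (Y j) * P (Sum.inl i) (Sum.inr j) +
        ∑ j, ∑ j', c (Y j) (Y j') * P (Sum.inr j) (Sum.inr j') +
        lam * (∑ i, |s i| + ∑ j, |t j|) := by
  simp [discreteObj₁, augCost, Fintype.sum_sum_type, hP]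

lemma cutPart_nonneg {P : Matrix (Fin n) (Fin m) ℝ} (hP : ∀ i j, 0 ≤ P i j) (i : Fin n)
    (j : Fin m) : 0 ≤ cutPart c lam X Y P i j := by
  unfold cutPart
  split_ifs
  exacts [hP i j, le_rfl]

lemma cutPart_le {P : Matrix (Fin n) (Fin m) ℝ} (hP : ∀ i j, 0 ≤ P i j) (i : Fin n)
    (j : Fin m) : cutPart c lam X Y P i j ≤ P i j := by
  unfold cutPart
  split_ifs
  exacts [le_rfl, hP i j]

lemma discreteFeasible₁_toPlan {P : Matrix (Fin n) (Fin m) ℝ} (hP : DiscreteFeasible₂ μ ν P) :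
    DiscreteFeasible₁ μ ν (toPlan c lam X Y P) (toS c lam X Y P) (toT c lam X Y P) where
  nonneg k l := by
    have hR := cutPart_nonneg (c := c) (lam := lam) (X := X) (Y := Y) hP.nonneg
    rcases k with i | j <;> rcases l with i' | j'
    · simp [toPlan]
    · simpa [toPlan] using cutPart_le hP.nonneg i j'
    · simp [toPlan]
    · simp only [toPlan, Matrix.fromBlocks_apply₂₂, Matrix.diagonal_apply]
      split_ifs
      exacts [Finset.sum_nonneg fun i _ => hR i j, le_rfl]
  row_left i := by
    simp [toPlan, toS, Fintype.sum_sum_type, Finset.sum_sub_distrib, hP.row, ← sub_eq_add_neg]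
  row_right j := by simp [toPlan, Fintype.sum_sum_type, Matrix.diagonal_apply]
  col_left i := by simp [toPlan, Fintype.sum_sum_type]
  col_right j := by
    simp [toPlan, toT, Fintype.sum_sum_type, Finset.sum_sub_distrib, hP.col,
      Matrix.diagonal_apply]
  sum_zero := by
    simp only [toS, toT, Finset.sum_neg_distrib]
    rw [Finset.sum_comm, neg_add_cancel]

/-- The mass cut from entry `(i, j)` costs nothing on the diagonal and `λ` in each of `s` and `t`,
which is its truncated cost `2λ`. -/
lemma discreteObj₁_toPlan (hc_self : ∀ x, c x x = 0) {P : Matrix (Fin n) (Fin m) ℝ}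
    (hP : ∀ i j, 0 ≤ P i j) :
    discreteObj₁ c lam X Y (toPlan c lam X Y P) (toS c lam X Y P) (toT c lam X Y P) =
      discreteObj₂ c lam X Y P := by
  have hR := cutPart_nonneg (c := c) (lam := lam) (X := X) (Y := Y) hP
  rw [discreteObj₁_eq _ _ _ (by rintro (k | k) i <;> simp [toPlan])]
  have hs : ∑ i, |toS c lam X Y P i| = ∑ i, ∑ j, cutPart c lam X Y P i j :=
    Finset.sum_congr rfl fun i _ => by
      rw [toS, abs_neg, abs_of_nonneg (Finset.sum_nonneg fun j _ => hR i j)]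
  have ht : ∑ j, |toT c lam X Y P j| = ∑ i, ∑ j, cutPart c lam X Y P i j := by
    refine Eq.trans (Finset.sum_congr rfl fun j _ => ?_) Finset.sum_comm
    rw [toT, abs_of_nonneg (Finset.sum_nonneg fun i _ => hR i j)]
  have hd : ∑ j, ∑ j', c (Y j) (Y j') * toPlan c lam X Y P (Sum.inr j) (Sum.inr j') = 0 := by
    simp [toPlan, Matrix.diagonal_apply, hc_self]
  rw [hs, ht, hd, add_zero, ← two_mul, Finset.mul_sum, Finset.mul_sum, ← Finset.sum_add_distrib]
  refine Finset.sum_congr rfl fun i _ => ?_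
  rw [Finset.mul_sum, Finset.mul_sum, ← Finset.sum_add_distrib]
  refine Finset.sum_congr rfl fun j _ => ?_
  simp only [toPlan, Matrix.fromBlocks_apply₁₂, Matrix.sub_apply, truncCost, cutPart]
  split_ifs with h
  · rw [min_eq_right h.le]
    ring
  · rw [min_eq_left (not_lt.1 h)]
    ring

namespace DiscreteFeasible₁

variable {P : Matrix (Fin n ⊕ Fin m) (Fin n ⊕ Fin m) ℝ} {s : Fin n → ℝ} {t : Fin m → ℝ}

lemma apply_inl (h : DiscreteFeasible₁ μ ν P s t) (k : Fin n ⊕ Fin m) (i : Fin n) :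
    P k (Sum.inl i) = 0 :=
  (Finset.sum_eq_zero_iff_of_nonneg fun k _ => h.nonneg k _).1 (h.col_left i) k
    (Finset.mem_univ k)

lemma row (h : DiscreteFeasible₁ μ ν P s t) (i : Fin n) :
    ∑ j, P (Sum.inl i) (Sum.inr j) = μ i + s i := by
  simpa [Fintype.sum_sum_type, h.apply_inl] using h.row_left i

lemma sum_inl_le (h : DiscreteFeasible₁ μ ν P s t) (j : Fin m) :
    ∑ i, P (Sum.inl i) (Sum.inr j) ≤ ν j := by
  rw [← h.col_right j, Fintype.sum_sum_type]
  exact le_add_of_nonneg_right (Finset.sum_nonneg fun _ _ => h.nonneg _ _)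

lemma add_nonneg (h : DiscreteFeasible₁ μ ν P s t) (i : Fin n) : 0 ≤ μ i + s i :=
  h.row_left i ▸ Finset.sum_nonneg fun _ _ => h.nonneg _ _

lemma t_nonneg (h : DiscreteFeasible₁ μ ν P s t) (j : Fin m) : 0 ≤ t j :=
  h.row_right j ▸ Finset.sum_nonneg fun _ _ => h.nonneg _ _

lemma keptPart_nonneg (h : DiscreteFeasible₁ μ ν P s t) (hμ : ∀ i, 0 ≤ μ i) (i : Fin n)
    (j : Fin m) : 0 ≤ keptPart μ P s i j :=
  mul_nonneg (div_nonneg (le_min (hμ i) (h.add_nonneg i)) (h.add_nonneg i)) (h.nonneg _ _)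

lemma keptPart_le (h : DiscreteFeasible₁ μ ν P s t) (i : Fin n) (j : Fin m) :
    keptPart μ P s i j ≤ P (Sum.inl i) (Sum.inr j) :=
  mul_le_of_le_one_left (h.nonneg _ _) (div_le_one_of_le₀ (min_le_right _ _) (h.add_nonneg i))

lemma sum_keptPart_row (h : DiscreteFeasible₁ μ ν P s t) (hμ : ∀ i, 0 ≤ μ i) (i : Fin n) :
    ∑ j, keptPart μ P s i j = μ i - max (-s i) 0 := by
  have hmin : min (μ i) (μ i + s i) = μ i - max (-s i) 0 := by
    rcases le_total (s i) 0 with hs | hs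
    · rw [min_eq_right (by linarith), max_eq_left (by linarith)]
      ring
    · rw [min_eq_left (by linarith), max_eq_right (by linarith), sub_zero]
  simp only [keptPart]
  rw [← Finset.mul_sum, h.row, ← hmin]
  -- An empty row has the junk factor `0 / 0 = 0`; then `min {μ i, μ i + s i} = 0` as well.
  rcases (h.add_nonneg i).eq_or_lt with h0 | h0
  · rw [← h0, mul_zero, min_eq_right (hμ i)]
  · exact div_mul_cancel₀ _ h0.ne'

lemma sum_keptPart_col_le (h : DiscreteFeasible₁ μ ν P s t) (j : Fin m) :
    ∑ i, keptPart μ P s i j ≤ ν j :=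
  (Finset.sum_le_sum fun i _ => h.keptPart_le i j).trans (h.sum_inl_le j)

/-- The mass missing in the columns of the kept part is the mass missing in its rows. -/
lemma sum_deficit (h : DiscreteFeasible₁ μ ν P s t) (hμ : μ ∈ stdSimplex ℝ (Fin n))
    (hν : ν ∈ stdSimplex ℝ (Fin m)) :
    ∑ j, (ν j - ∑ i, keptPart μ P s i j) = ∑ i, max (-s i) 0 := by
  rw [Finset.sum_sub_distrib, Finset.sum_comm, hν.2,
    Finset.sum_congr rfl fun i _ => h.sum_keptPart_row hμ.1 i, Finset.sum_sub_distrib, hμ.2]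
  ring

lemma sum_redistributed_row (h : DiscreteFeasible₁ μ ν P s t) (hμ : μ ∈ stdSimplex ℝ (Fin n))
    (hν : ν ∈ stdSimplex ℝ (Fin m)) (i : Fin n) :
    ∑ j, max (-s i) 0 * (ν j - ∑ i', keptPart μ P s i' j) / ∑ i', max (-s i') 0 =
      max (-s i) 0 := by
  rw [← Finset.sum_div, ← Finset.mul_sum, h.sum_deficit hμ hν]
  -- If the denominator vanishes, then so does every term of it, in particular the right-hand side.
  refine mul_div_cancel_of_imp fun hD => ?_
  exact (Finset.sum_eq_zero_iff_of_nonneg fun _ _ => le_max_right _ _).1 hD i (Finset.mem_univ i)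

lemma sum_redistributed_col (h : DiscreteFeasible₁ μ ν P s t) (hμ : μ ∈ stdSimplex ℝ (Fin n))
    (hν : ν ∈ stdSimplex ℝ (Fin m)) (j : Fin m) :
    ∑ i, max (-s i) 0 * (ν j - ∑ i', keptPart μ P s i' j) / ∑ i', max (-s i') 0 =
      ν j - ∑ i', keptPart μ P s i' j := by
  rw [← Finset.sum_div, ← Finset.sum_mul]
  -- If the denominator vanishes, then so does the total deficit, hence the deficit of column `j`.
  refine mul_div_cancel_left_of_imp fun hD => ?_
  rw [← h.sum_deficit hμ hν] at hD
  exact (Finset.sum_eq_zero_iff_of_nonneg fun j _ => sub_nonneg.2 (h.sum_keptPart_col_le j)).1 hD j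
    (Finset.mem_univ j)

lemma discreteFeasible₂_ofPlan (h : DiscreteFeasible₁ μ ν P s t) (hμ : μ ∈ stdSimplex ℝ (Fin n))
    (hν : ν ∈ stdSimplex ℝ (Fin m)) : DiscreteFeasible₂ μ ν (ofPlan μ ν P s) where
  nonneg i j := _root_.add_nonneg (h.keptPart_nonneg hμ.1 i j) <|
    div_nonneg (mul_nonneg (le_max_right _ _) (sub_nonneg.2 (h.sum_keptPart_col_le j)))
      (Finset.sum_nonneg fun _ _ => le_max_right _ _)
  row i := by
    simp only [ofPlan]
    rw [Finset.sum_add_distrib, h.sum_redistributed_row hμ hν, h.sum_keptPart_row hμ.1,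
      sub_add_cancel]
  col j := by
    simp only [ofPlan]
    rw [Finset.sum_add_distrib, h.sum_redistributed_col hμ hν, add_sub_cancel]

/-- Since `s` and `t` have total mass zero and `t ≥ 0`, their `ℓ¹` norm is twice the mass of the
negative part of `s`. -/
lemma sum_abs (h : DiscreteFeasible₁ μ ν P s t) :
    ∑ i, |s i| + ∑ j, |t j| = 2 * ∑ i, max (-s i) 0 := by
  have hs : ∑ i, |s i| = ∑ i, s i + 2 * ∑ i, max (-s i) 0 := by
    rw [Finset.mul_sum, ← Finset.sum_add_distrib]
    refine Finset.sum_congr rfl fun i _ => ?_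
    rcases le_total (s i) 0 with hs | hs
    · rw [abs_of_nonpos hs, max_eq_left (by linarith)]
      ring
    · rw [abs_of_nonneg hs, max_eq_right (by linarith)]
      ring
  rw [hs, Finset.sum_congr rfl fun j _ => abs_of_nonneg (h.t_nonneg j)]
  linarith [h.sum_zero]

/-- The kept part costs at most what it cost before, and the redistributed mass, which is the mass
of the negative part of `s`, at most `2λ` per unit. -/
lemma discreteObj₂_ofPlan_le (hc_nonneg : ∀ x y, 0 ≤ c x y) (h : DiscreteFeasible₁ μ ν P s t)
    (hμ : μ ∈ stdSimplex ℝ (Fin n)) (hν : ν ∈ stdSimplex ℝ (Fin m)) :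
    discreteObj₂ c lam X Y (ofPlan μ ν P s) ≤ discreteObj₁ c lam X Y P s t := by
  rw [discreteObj₁_eq _ _ _ h.apply_inl, h.sum_abs]
  have hB : 0 ≤ ∑ j, ∑ j', c (Y j) (Y j') * P (Sum.inr j) (Sum.inr j') :=
    Finset.sum_nonneg fun _ _ => Finset.sum_nonneg fun _ _ =>
      mul_nonneg (hc_nonneg _ _) (h.nonneg _ _)
  have hA : discreteObj₂ c lam X Y (ofPlan μ ν P s) ≤
      ∑ i, ∑ j, (c (X i) (Y j) * P (Sum.inl i) (Sum.inr j) + 2 * lam *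
        (max (-s i) 0 * (ν j - ∑ i', keptPart μ P s i' j) / ∑ i', max (-s i') 0)) := by
    refine Finset.sum_le_sum fun i _ => Finset.sum_le_sum fun j _ => ?_
    rw [ofPlan, mul_add]
    refine add_le_add ?_ (mul_le_mul_of_nonneg_right (min_le_right _ _) ?_)
    · exact (mul_le_mul_of_nonneg_right (min_le_left _ _) (h.keptPart_nonneg hμ.1 i j)).trans
        (mul_le_mul_of_nonneg_left (h.keptPart_le i j) (hc_nonneg _ _))
    · exact div_nonneg (mul_nonneg (le_max_right _ _) (sub_nonneg.2 (h.sum_keptPart_col_le j)))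
        (Finset.sum_nonneg fun _ _ => le_max_right _ _)
  simp only [Finset.sum_add_distrib, ← Finset.mul_sum, h.sum_redistributed_row hμ hν] at hA
  linarith

end DiscreteFeasible₁

lemma isCompact_discreteFeasible₂ (μ : Fin n → ℝ) (ν : Fin m → ℝ) :
    IsCompact {P | DiscreteFeasible₂ μ ν P} := by
  have hK : IsCompact (Set.pi Set.univ fun _ : Fin n => Set.pi Set.univ fun j : Fin m =>
      Set.Icc 0 (ν j)) :=
    isCompact_univ_pi fun _ => isCompact_univ_pi fun _ => isCompact_Icc
  refine hK.of_isClosed_subset ?_ fun P hP i _ j _ => ⟨hP.nonneg i j, ?_⟩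
  · have : {P : Matrix (Fin n) (Fin m) ℝ | DiscreteFeasible₂ μ ν P} =
        {P | (∀ i j, 0 ≤ P i j) ∧ (∀ i, ∑ j, P i j = μ i) ∧ ∀ j, ∑ i, P i j = ν j} :=
      Set.ext fun P => ⟨fun h => ⟨h.1, h.2, h.3⟩, fun h => ⟨h.1, h.2.1, h.2.2⟩⟩
    rw [this]
    simp only [Set.ofPred_and, Set.ofPred_forall]
    refine IsClosed.inter ?_ (IsClosed.inter ?_ ?_)
    · exact isClosed_iInter fun i => isClosed_iInter fun j =>
        isClosed_le continuous_const (by fun_prop)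
    · exact isClosed_iInter fun i => isClosed_eq (by fun_prop) continuous_const
    · exact isClosed_iInter fun j => isClosed_eq (by fun_prop) continuous_const
  · rw [← hP.col j]
    exact Finset.single_le_sum (f := fun i => P i j) (fun i _ => hP.nonneg i j)
      (Finset.mem_univ i)

lemma exists_discreteOptimal₂ (c : 𝒳 → 𝒳 → ℝ) (lam : ℝ) (X : Fin n → 𝒳) (Y : Fin m → 𝒳)
    (hμ : μ ∈ stdSimplex ℝ (Fin n)) (hν : ν ∈ stdSimplex ℝ (Fin m)) :
    ∃ P, DiscreteOptimal₂ c lam X Y μ ν P := by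
  have hne : {P | DiscreteFeasible₂ μ ν P}.Nonempty :=
    ⟨fun i j => μ i * ν j, fun i j => mul_nonneg (hμ.1 i) (hν.1 j),
      fun i => by rw [← Finset.mul_sum, hν.2, mul_one],
      fun j => by rw [← Finset.sum_mul, hμ.2, one_mul]⟩
  have hcont : Continuous (discreteObj₂ c lam X Y) := by
    unfold discreteObj₂
    fun_prop
  obtain ⟨P, hP, hmin⟩ :=
    (isCompact_discreteFeasible₂ μ ν).exists_isMinOn hne hcont.continuousOn
  exact ⟨P, hP, fun P' hP' => hmin hP'⟩

lemma DiscreteOptimal₂.toPlan (hc_nonneg : ∀ x y, 0 ≤ c x y) (hc_self : ∀ x, c x x = 0)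
    (hμ : μ ∈ stdSimplex ℝ (Fin n)) (hν : ν ∈ stdSimplex ℝ (Fin m))
    {P : Matrix (Fin n) (Fin m) ℝ} (hP : DiscreteOptimal₂ c lam X Y μ ν P) :
    DiscreteOptimal₁ c lam X Y μ ν (toPlan c lam X Y P) (toS c lam X Y P) (toT c lam X Y P) :=
  ⟨discreteFeasible₁_toPlan hP.1, fun _ _ _ h =>
    (discreteObj₁_toPlan hc_self hP.1.nonneg).trans_le <|
      (hP.2 _ (h.discreteFeasible₂_ofPlan hμ hν)).trans (h.discreteObj₂_ofPlan_le hc_nonneg hμ hν)⟩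

lemma DiscreteOptimal₁.ofPlan (hc_nonneg : ∀ x y, 0 ≤ c x y) (hc_self : ∀ x, c x x = 0)
    (hμ : μ ∈ stdSimplex ℝ (Fin n)) (hν : ν ∈ stdSimplex ℝ (Fin m))
    {P : Matrix (Fin n ⊕ Fin m) (Fin n ⊕ Fin m) ℝ} {s : Fin n → ℝ} {t : Fin m → ℝ}
    (hP : DiscreteOptimal₁ c lam X Y μ ν P s t) :
    DiscreteOptimal₂ c lam X Y μ ν (ofPlan μ ν P s) :=
  ⟨hP.1.discreteFeasible₂_ofPlan hμ hν, fun _ h =>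
    (hP.1.discreteObj₂_ofPlan_le hc_nonneg hμ hν).trans <|
      (hP.2 _ _ _ (discreteFeasible₁_toPlan h)).trans_eq (discreteObj₁_toPlan hc_self h.nonneg)⟩

lemma exists_isLeast_discreteValues (hc_nonneg : ∀ x y, 0 ≤ c x y) (hc_self : ∀ x, c x x = 0)
    (hμ : μ ∈ stdSimplex ℝ (Fin n)) (hν : ν ∈ stdSimplex ℝ (Fin m)) :
    ∃ v : ℝ, IsLeast (discreteValues₁ c lam X Y μ ν) v ∧
      IsLeast (discreteValues₂ c lam X Y μ ν) v := by
  obtain ⟨P, hP⟩ := exists_discreteOptimal₂ c lam X Y hμ hν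
  have hQ := hP.toPlan hc_nonneg hc_self hμ hν
  refine ⟨discreteObj₂ c lam X Y P,
    ⟨⟨_, _, _, hQ.1, discreteObj₁_toPlan hc_self hP.1.nonneg⟩, ?_⟩, ⟨P, hP.1, rfl⟩, ?_⟩
  · rintro _ ⟨P', s', t', h', rfl⟩
    exact (discreteObj₁_toPlan hc_self hP.1.nonneg).symm.trans_le (hQ.2 _ _ _ h')
  · rintro _ ⟨P', h', rfl⟩
    exact hP.2 _ h'

end Discrete

open MeasureTheory
open scoped ENNReal

/-! ### Minimality of the Jordan decomposition -/

section Jordan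

variable {α : Type*} [MeasurableSpace α]

/-- Minimality of the Jordan decomposition, free of subtraction: if `a - b = p - q` and `a`, `b` are
mutually singular, then `b ≤ q`. -/
lemma le_of_mutuallySingular_of_add_eq_add {a b p q : Measure α} (hab : a.MutuallySingular b)
    (h : a + q = p + b) : b ≤ q := by
  obtain ⟨S, hS, haS, hbS⟩ := hab
  refine Measure.le_iff.2 fun A hA => ?_
  have hbA : b A = b (A ∩ S) := by
    rw [← measure_inter_add_sdiff A hS, Set.sdiff_eq,
      measure_mono_null Set.inter_subset_right hbS, add_zero]
  have haA : a (A ∩ S) = 0 := measure_mono_null Set.inter_subset_right haS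
  calc b A = b (A ∩ S) := hbA
    _ ≤ (p + b) (A ∩ S) := by
      rw [Measure.add_apply]
      exact le_add_self
    _ = q (A ∩ S) := by rw [← h, Measure.add_apply, haA, zero_add]
    _ ≤ q A := measure_mono Set.inter_subset_left

variable {s : SignedMeasure α} {p q : Measure α} [IsFiniteMeasure p] [IsFiniteMeasure q]

lemma posPart_add_eq_add_negPart (h : ∀ A, MeasurableSet A → s A = p.real A - q.real A) :
    s.toJordanDecomposition.posPart + q = p + s.toJordanDecomposition.negPart := by
  ext A hA
  rw [← measureReal_eq_measureReal_iff, measureReal_add_apply, measureReal_add_apply]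
  have h1 := s.apply_eq_posPart_real_sub_negPart_real hA
  have h2 := h A hA
  linarith

lemma negPart_le_of_eq_sub (h : ∀ A, MeasurableSet A → s A = p.real A - q.real A) :
    s.toJordanDecomposition.negPart ≤ q :=
  le_of_mutuallySingular_of_add_eq_add s.toJordanDecomposition.mutuallySingular
    (posPart_add_eq_add_negPart h)

lemma posPart_le_of_eq_sub (h : ∀ A, MeasurableSet A → s A = p.real A - q.real A) :
    s.toJordanDecomposition.posPart ≤ p := by
  refine le_of_mutuallySingular_of_add_eq_add s.toJordanDecomposition.mutuallySingular.symm
    (p := q) ?_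
  rw [add_comm, ← posPart_add_eq_add_negPart h, add_comm]

end Jordan

/-! ### General probability measures -/

section General

variable {𝒳 : Type*} [MeasurableSpace 𝒳] {c : 𝒳 → 𝒳 → ℝ} {lam : ℝ} {μ ν : Measure 𝒳}

lemma restrict_add_cutMeasure (hc : Measurable fun p : 𝒳 × 𝒳 => c p.1 p.2)
    (π : Measure (𝒳 × 𝒳)) :
    π.restrict {p | c p.1 p.2 ≤ 2 * lam} + cutMeasure c lam π = π := by
  have : {p : 𝒳 × 𝒳 | 2 * lam < c p.1 p.2} = {p | c p.1 p.2 ≤ 2 * lam}ᶜ := by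
    ext p
    simp
  rw [cutMeasure, this]
  exact Measure.restrict_add_restrict_compl (hc measurableSet_Iic)

lemma fst_map_diag (ρ : Measure (𝒳 × 𝒳)) : (ρ.map fun p => (p.2, p.2)).fst = ρ.snd :=
  Measure.fst_map_prodMk measurable_snd

lemma snd_map_diag (ρ : Measure (𝒳 × 𝒳)) : (ρ.map fun p => (p.2, p.2)).snd = ρ.snd :=
  Measure.snd_map_prodMk measurable_snd

lemma toSigned_apply (π : Measure (𝒳 × 𝒳)) [IsFiniteMeasure π] {A : Set 𝒳}
    (hA : MeasurableSet A) :
    toSigned c lam π A = (cutMeasure c lam π).snd.real A - (cutMeasure c lam π).fst.real A :=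
  Measure.toSignedMeasure_sub_apply hA

lemma feasible₁_toMeasure (hc : Measurable fun p : 𝒳 × 𝒳 => c p.1 p.2) {π : Measure (𝒳 × 𝒳)}
    [IsFiniteMeasure π] (hπ : Feasible₂ μ ν π) :
    Feasible₁ μ ν (toMeasure c lam π) (toSigned c lam π) where
  fst A hA := by
    rw [toSigned_apply π hA, ← hπ.fst]
    conv_rhs => rw [← restrict_add_cutMeasure (lam := lam) hc π]
    rw [toMeasure, Measure.fst_add, Measure.fst_add, fst_map_diag, measureReal_add_apply,
      measureReal_add_apply, restrict_add_cutMeasure hc]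
    ring
  snd := by
    rw [toMeasure, Measure.snd_add, snd_map_diag, ← Measure.snd_add, restrict_add_cutMeasure hc,
      hπ.snd]
  mass_zero := by
    rw [toSigned_apply π MeasurableSet.univ]
    rw [measureReal_def, measureReal_def, Measure.snd_univ, Measure.fst_univ, sub_self]

/-- A unit of mass cut from `{c > 2λ}` costs nothing on the diagonal and at most `2λ` in the total
variation, which is its truncated cost. -/
lemma obj₁_toMeasure_le (hc_self : ∀ x, c x x = 0)
    (hc : Measurable fun p : 𝒳 × 𝒳 => c p.1 p.2) (π : Measure (𝒳 × 𝒳)) [IsFiniteMeasure π] :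
    obj₁ c lam (toMeasure c lam π) (toSigned c lam π) ≤ obj₂ c lam π := by
  have hpos := posPart_le_of_eq_sub fun A => toSigned_apply (c := c) (lam := lam) π (A := A)
  have hneg := negPart_le_of_eq_sub fun A => toSigned_apply (c := c) (lam := lam) π (A := A)
  have htv : (toSigned c lam π).totalVariation Set.univ ≤ 2 * cutMeasure c lam π Set.univ := by
    rw [SignedMeasure.totalVariation, Measure.add_apply, two_mul]
    exact add_le_add ((hpos _).trans_eq Measure.snd_univ) ((hneg _).trans_eq Measure.fst_univ)
  have hdiag : ∫⁻ p, ENNReal.ofReal (c p.1 p.2)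
      ∂(cutMeasure c lam π).map (fun p => (p.2, p.2)) = 0 := by
    rw [lintegral_map hc.ennreal_ofReal (by fun_prop)]
    simp [hc_self]
  have hlow : ∫⁻ p, ENNReal.ofReal (c p.1 p.2) ∂π.restrict {p | c p.1 p.2 ≤ 2 * lam} =
      ∫⁻ p, ENNReal.ofReal (truncCost c lam p.1 p.2) ∂π.restrict {p | c p.1 p.2 ≤ 2 * lam} :=
    setLIntegral_congr_fun (hc measurableSet_Iic) fun p hp => by
      rw [truncCost, min_eq_left hp]
  have hhigh : ENNReal.ofReal (2 * lam) * cutMeasure c lam π Set.univ =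
      ∫⁻ p, ENNReal.ofReal (truncCost c lam p.1 p.2) ∂cutMeasure c lam π := by
    rw [← lintegral_const]
    exact setLIntegral_congr_fun (hc measurableSet_Ioi) fun p hp => by
      rw [truncCost, min_eq_right (le_of_lt hp)]
  calc obj₁ c lam (toMeasure c lam π) (toSigned c lam π)
      ≤ ∫⁻ p, ENNReal.ofReal (c p.1 p.2) ∂π.restrict {p | c p.1 p.2 ≤ 2 * lam} +
        ENNReal.ofReal lam * (2 * cutMeasure c lam π Set.univ) := by
        rw [obj₁, toMeasure, lintegral_add_measure, hdiag, add_zero]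
        gcongr
    _ = ∫⁻ p, ENNReal.ofReal (truncCost c lam p.1 p.2) ∂π.restrict {p | c p.1 p.2 ≤ 2 * lam} +
        ∫⁻ p, ENNReal.ofReal (truncCost c lam p.1 p.2) ∂cutMeasure c lam π := by
        rw [hlow, ← hhigh, ENNReal.ofReal_mul zero_le_two, ENNReal.ofReal_ofNat]
        ring
    _ = obj₂ c lam π := by
        rw [← lintegral_add_measure, restrict_add_cutMeasure hc, obj₂]

namespace Feasible₁

variable {π : Measure (𝒳 × 𝒳)} {s : SignedMeasure 𝒳}

lemma isFiniteMeasure [IsFiniteMeasure ν] (h : Feasible₁ μ ν π s) : IsFiniteMeasure π :=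
  ⟨by rw [← Measure.snd_univ, h.snd]; exact measure_lt_top _ _⟩

lemma eq_sub (h : Feasible₁ μ ν π s) (A : Set 𝒳) (hA : MeasurableSet A) :
    s A = π.fst.real A - μ.real A := by
  rw [h.fst A hA, add_sub_cancel_left]

lemma negPart_le [IsFiniteMeasure μ] [IsFiniteMeasure π] (h : Feasible₁ μ ν π s) :
    s.toJordanDecomposition.negPart ≤ μ :=
  negPart_le_of_eq_sub h.eq_sub

lemma sub_negPart_le_fst [IsFiniteMeasure μ] [IsFiniteMeasure π] (h : Feasible₁ μ ν π s) :
    μ - s.toJordanDecomposition.negPart ≤ π.fst := by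
  refine Measure.sub_le_of_le_add ?_
  rw [← posPart_add_eq_add_negPart h.eq_sub]
  exact Measure.le_add_left le_rfl

lemma posPart_univ (h : Feasible₁ μ ν π s) :
    s.toJordanDecomposition.posPart Set.univ = s.toJordanDecomposition.negPart Set.univ := by
  rw [← measureReal_eq_measureReal_iff, ← sub_eq_zero,
    ← s.apply_eq_posPart_real_sub_negPart_real MeasurableSet.univ, h.mass_zero]

lemma keptMeasure_le [IsFiniteMeasure μ] [IsFiniteMeasure π] (h : Feasible₁ μ ν π s) :
    keptMeasure μ π s ≤ π := by
  have hd := ae_of_ae_map measurable_fst.aemeasurable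
    (Measure.rnDeriv_le_one_of_le h.sub_negPart_le_fst)
  exact (withDensity_mono hd).trans_eq withDensity_one

lemma fst_keptMeasure [IsFiniteMeasure μ] [IsFiniteMeasure π] (h : Feasible₁ μ ν π s) :
    (keptMeasure μ π s).fst = μ - s.toJordanDecomposition.negPart := by
  rw [← Measure.withDensity_rnDeriv_eq _ _ h.sub_negPart_le_fst.absolutelyContinuous]
  ext A hA
  have hm := Measure.measurable_rnDeriv (μ - s.toJordanDecomposition.negPart) π.fst
  rw [Measure.fst_apply hA, keptMeasure, withDensity_apply _ (measurable_fst hA),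
    withDensity_apply _ hA]
  exact (setLIntegral_map hA hm measurable_fst).symm

lemma snd_keptMeasure_le [IsFiniteMeasure μ] [IsFiniteMeasure π] (h : Feasible₁ μ ν π s) :
    (keptMeasure μ π s).snd ≤ ν :=
  (Measure.snd_mono h.keptMeasure_le).trans_eq h.snd

/-- The mass missing in the second marginal of the kept part is the mass missing in the first. -/
lemma deficit_univ [IsProbabilityMeasure μ] [IsProbabilityMeasure ν] [IsFiniteMeasure π]
    (h : Feasible₁ μ ν π s) :
    (ν - (keptMeasure μ π s).snd) Set.univ = s.toJordanDecomposition.negPart Set.univ := by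
  have : IsFiniteMeasure (keptMeasure μ π s) := isFiniteMeasure_of_le π h.keptMeasure_le
  rw [Measure.sub_apply MeasurableSet.univ h.snd_keptMeasure_le, Measure.snd_univ,
    ← Measure.fst_univ, h.fst_keptMeasure, Measure.sub_apply MeasurableSet.univ h.negPart_le,
    measure_univ, measure_univ]
  exact ENNReal.sub_sub_cancel ENNReal.one_ne_top ((h.negPart_le _).trans_eq measure_univ)

lemma fst_redistributed [IsProbabilityMeasure μ] [IsProbabilityMeasure ν] [IsFiniteMeasure π]
    (h : Feasible₁ μ ν π s) :
    ((s.toJordanDecomposition.negPart Set.univ)⁻¹ •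
      s.toJordanDecomposition.negPart.prod (ν - (keptMeasure μ π s).snd)).fst =
      s.toJordanDecomposition.negPart := by
  ext A hA
  rw [Measure.fst_apply hA, Measure.smul_apply, ← Set.prod_univ, Measure.prod_prod, h.deficit_univ,
    smul_eq_mul, mul_comm (s.toJordanDecomposition.negPart A)]
  -- The factor is `0⁻¹ = ∞` when `s⁻ = 0`, but it then multiplies the zero measure.
  exact ENNReal.inv_mul_cancel_left' (fun h0 => measure_mono_null (Set.subset_univ A) h0)
    fun htop => absurd htop (measure_ne_top _ _)

lemma snd_redistributed [IsProbabilityMeasure μ] [IsProbabilityMeasure ν] [IsFiniteMeasure π]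
    (h : Feasible₁ μ ν π s) :
    ((s.toJordanDecomposition.negPart Set.univ)⁻¹ •
      s.toJordanDecomposition.negPart.prod (ν - (keptMeasure μ π s).snd)).snd =
      ν - (keptMeasure μ π s).snd := by
  ext A hA
  rw [Measure.snd_apply hA, Measure.smul_apply, ← Set.univ_prod, Measure.prod_prod, smul_eq_mul]
  -- If `s⁻ = 0`, then the second marginal of the kept part has no deficit either.
  refine ENNReal.inv_mul_cancel_left' (fun h0 => ?_) fun htop => absurd htop (measure_ne_top _ _)
  exact measure_mono_null (Set.subset_univ A) (h.deficit_univ.trans h0)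

lemma feasible₂_ofMeasure [IsProbabilityMeasure μ] [IsProbabilityMeasure ν]
    (h : Feasible₁ μ ν π s) : Feasible₂ μ ν (ofMeasure μ ν π s) := by
  have := h.isFiniteMeasure
  have : IsFiniteMeasure (keptMeasure μ π s) := isFiniteMeasure_of_le π h.keptMeasure_le
  constructor
  · rw [ofMeasure, Measure.fst_add, h.fst_redistributed, h.fst_keptMeasure,
      Measure.sub_add_cancel_of_le h.negPart_le]
  · rw [ofMeasure, Measure.snd_add, h.snd_redistributed, add_comm,
      Measure.sub_add_cancel_of_le h.snd_keptMeasure_le]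

/-- The kept part costs at most what it cost before, and the redistributed mass, which is half the
total variation of `s`, at most `2λ` per unit. -/
lemma obj₂_ofMeasure_le [IsProbabilityMeasure μ] [IsProbabilityMeasure ν]
    (h : Feasible₁ μ ν π s) : obj₂ c lam (ofMeasure μ ν π s) ≤ obj₁ c lam π s := by
  have := h.isFiniteMeasure
  rw [obj₂, ofMeasure, lintegral_add_measure, obj₁]
  refine add_le_add ?_ ?_
  · exact (lintegral_mono fun p => ENNReal.ofReal_le_ofReal (min_le_left _ _)).trans
      (lintegral_mono' h.keptMeasure_le le_rfl)
  · refine (lintegral_mono (g := fun _ => ENNReal.ofReal (2 * lam)) fun p =>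
      ENNReal.ofReal_le_ofReal (min_le_right _ _)).trans ?_
    rw [lintegral_const, ← Measure.fst_univ, h.fst_redistributed, SignedMeasure.totalVariation,
      Measure.add_apply, h.posPart_univ, ENNReal.ofReal_mul zero_le_two, ENNReal.ofReal_ofNat]
    exact le_of_eq (by ring)

end Feasible₁

lemma Feasible₂.isFiniteMeasure {π : Measure (𝒳 × 𝒳)} [IsFiniteMeasure ν]
    (h : Feasible₂ μ ν π) : IsFiniteMeasure π :=
  ⟨by rw [← Measure.snd_univ, h.snd]; exact measure_lt_top _ _⟩

lemma value₁_eq_value₂ (hc_self : ∀ x, c x x = 0)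
    (hc : Measurable fun p : 𝒳 × 𝒳 => c p.1 p.2) [IsProbabilityMeasure μ]
    [IsProbabilityMeasure ν] : value₁ c lam μ ν = value₂ c lam μ ν := by
  refine le_antisymm (le_sInf ?_) (le_sInf ?_)
  · rintro _ ⟨π, h, rfl⟩
    have := h.isFiniteMeasure
    exact sInf_le_of_le ⟨_, _, feasible₁_toMeasure hc h, rfl⟩
      (obj₁_toMeasure_le hc_self hc π)
  · rintro _ ⟨π, s, h, rfl⟩
    exact sInf_le_of_le ⟨_, h.feasible₂_ofMeasure, rfl⟩ h.obj₂_ofMeasure_le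

lemma Optimal₂.toMeasure (hc_self : ∀ x, c x x = 0)
    (hc : Measurable fun p : 𝒳 × 𝒳 => c p.1 p.2) [IsProbabilityMeasure μ]
    [IsProbabilityMeasure ν] {π : Measure (𝒳 × 𝒳)} [IsFiniteMeasure π]
    (hπ : Optimal₂ c lam μ ν π) :
    Optimal₁ c lam μ ν (toMeasure c lam π) (toSigned c lam π) :=
  ⟨feasible₁_toMeasure hc hπ.1, fun _ _ h => (obj₁_toMeasure_le hc_self hc π).trans <|
    (hπ.2 _ h.feasible₂_ofMeasure).trans h.obj₂_ofMeasure_le⟩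

lemma Optimal₁.ofMeasure (hc_self : ∀ x, c x x = 0)
    (hc : Measurable fun p : 𝒳 × 𝒳 => c p.1 p.2) [IsProbabilityMeasure μ]
    [IsProbabilityMeasure ν] {π : Measure (𝒳 × 𝒳)} {s : SignedMeasure 𝒳}
    (hπ : Optimal₁ c lam μ ν π s) : Optimal₂ c lam μ ν (ofMeasure μ ν π s) :=
  ⟨hπ.1.feasible₂_ofMeasure, fun π' h => by
    have := h.isFiniteMeasure
    exact hπ.1.obj₂_ofMeasure_le.trans <|
      (hπ.2 _ _ (feasible₁_toMeasure hc h)).trans (obj₁_toMeasure_le hc_self hc π')⟩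

end General

end ROBOT

theorem theorem2 {𝒳 : Type*} (c : 𝒳 → 𝒳 → ℝ)
    (hc_nonneg : ∀ x y, 0 ≤ c x y) (hc_self : ∀ x, c x x = 0)
    (lam : ℝ) (hlam : 0 < lam) :
    -- finitely supported measures
    (∀ (n m : ℕ) (X : Fin n → 𝒳) (Y : Fin m → 𝒳) (μ : Fin n → ℝ) (ν : Fin m → ℝ),
      μ ∈ stdSimplex ℝ (Fin n) → ν ∈ stdSimplex ℝ (Fin m) →
      (∃ v : ℝ, IsLeast (ROBOT.discreteValues₁ c lam X Y μ ν) v ∧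
        IsLeast (ROBOT.discreteValues₂ c lam X Y μ ν) v) ∧
      (∀ P, ROBOT.DiscreteOptimal₂ c lam X Y μ ν P →
        ROBOT.DiscreteOptimal₁ c lam X Y μ ν (ROBOT.toPlan c lam X Y P)
          (ROBOT.toS c lam X Y P) (ROBOT.toT c lam X Y P)) ∧
      (∀ P s t, ROBOT.DiscreteOptimal₁ c lam X Y μ ν P s t →
        ROBOT.DiscreteOptimal₂ c lam X Y μ ν (ROBOT.ofPlan μ ν P s))) ∧
    -- general probability measures, when the cost is a metric
    (∀ [MeasurableSpace 𝒳], Measurable (fun p : 𝒳 × 𝒳 => c p.1 p.2) → ROBOT.IsMetric c →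
      ∀ (μ ν : MeasureTheory.Measure 𝒳) [MeasureTheory.IsProbabilityMeasure μ]
        [MeasureTheory.IsProbabilityMeasure ν],
      ROBOT.value₁ c lam μ ν = ROBOT.value₂ c lam μ ν ∧
      (∀ (π : MeasureTheory.Measure (𝒳 × 𝒳)) [MeasureTheory.IsProbabilityMeasure π],
        ROBOT.Optimal₂ c lam μ ν π →
        ROBOT.Optimal₁ c lam μ ν (ROBOT.toMeasure c lam π) (ROBOT.toSigned c lam π)) ∧
      (∀ (π : MeasureTheory.Measure (𝒳 × 𝒳)) (s : MeasureTheory.SignedMeasure 𝒳),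
        ROBOT.Optimal₁ c lam μ ν π s →
        ROBOT.Optimal₂ c lam μ ν (ROBOT.ofMeasure μ ν π s))) := by
  refine ⟨fun n m X Y μ ν hμ hν => ⟨ROBOT.exists_isLeast_discreteValues hc_nonneg hc_self hμ hν,
    fun P hP => hP.toPlan hc_nonneg hc_self hμ hν,
    fun P s t hP => hP.ofPlan hc_nonneg hc_self hμ hν⟩, ?_⟩
  intro _ hc _ μ ν _ _
  exact ⟨ROBOT.value₁_eq_value₂ hc_self hc, fun π _ hπ => hπ.toMeasure hc_self hc,
    fun π s hπ => hπ.ofMeasure hc_self hc⟩
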